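/- Let $D$ be a string link chord diagram of degree $k$ on $n$ components, i.e. $n$ disjoint oriented segments, numbered $1,\dots,n$, together with $k$ chords whose $2k$ endpoints are distinct points of the segments; the diagram is determined by the order of the endpoints on each segment. Let $\Gamma(D)$ be its intersection graph. It has a vertex for each chord, labeled by the unordered pair $\{i,j\}$ of (possibly equal) components on which the endpoints of the chord lie. It has a directed edge from $v$ to $w$ for each pair $(e_1,e_2)$ consisting of an endpoint $e_1$ of $v$ and an endpoint $e_2$ of $w$ on the same component such that the orientation of the component runs from $e_1$ to $e_2$; these edges are counted mod 2. The adjacency matrix of $\Gamma(D)$ is the $k\times k$ matrix over $\mathbb{Z}/2$ whose entry at $(v,w)$, $v\ne w$, is $1$ if (after cancelling mod 2) there is a directed edge from $v$ to $w$ and $0$ otherwise, and whose entry at $(v,v)$ is $1$ if the two labels of $v$ are different and $0$ if they are equal. Write $\det(\Gamma(D))\in\mathbb{Z}/2$ for its determinant. Let $C$ be the Conway weight system, the integer-valued function on chord diagrams determined by the following rules. The value $C(D)$ of a string link chord diagram is that of its closure, a chord diagram on oriented circles, obtained by joining the top of each component to its bottom. $C(D)=C(D_v)$ for every chord $v$,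 where $D_v$ is the result of surgery on $v$: the chord is replaced by a band compatible with the orientations, and the interior of the band and the intervals at which it is attached are removed. On the diagram that consists of $m$ circles and no chords, $C$ is $1$ if $m=1$ and $0$ otherwise. If $\det(\Gamma(D))=0$ in $\mathbb{Z}/2$, or if $k+n$ is even, then $C(D)=0$. -/

import Mathlib

/-- A string link chord diagram of degree `k` on `n` components: `n` disjoint oriented segments,
the `i`-th of which carries `len i` chord endpoints, numbered in the order in which the orientation
of the segment meets them, and `k` chords, the `v`-th of which joins the points `endpt (v, 0)` and
`endpt (v, 1)`. As `endpt` is a bijection, the `2 * k` endpoints are pairwise distinct and no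
other points are marked. The numbering of the chords and of the two ends of a chord is auxiliary. -/
structure StringChordDiagram (n k : ℕ) where
  /-- the number of chord endpoints on each component -/
  len : Fin n → ℕ
  /-- the two endpoints of each chord -/
  endpt : Fin k × Fin 2 ≃ (i : Fin n) × Fin (len i)

/-- A directed multigraph on the vertices `Fin k` with edges counted mod 2 (so that between two
vertices there is at most one edge in each direction), each vertex of which is labeled by an
unordered pair of elements of `Fin n`, possibly equal. -/
structure LabeledDigraph (n k : ℕ) where
  /-- the label of a vertex -/
  label : Fin k → Sym2 (Fin n)
  /-- there is a directed edge from the first vertex to the second -/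
  edge : Fin k → Fin k → Prop

open Classical in
/-- The adjacency matrix, over the field with two elements. Off the diagonal it records the
directed edges; a diagonal entry is `0` if the two labels of the vertex agree, and `1` otherwise. -/
noncomputable def LabeledDigraph.adj {n k : ℕ} (G : LabeledDigraph n k) :
    Matrix (Fin k) (Fin k) (ZMod 2) :=
  Matrix.of fun v w =>
    if v = w then (if (G.label v).IsDiag then 0 else 1) else (if G.edge v w then 1 else 0)

namespace StringChordDiagram

variable {n k : ℕ} (D : StringChordDiagram n k)

/-- `x` and `y` lie on the same component, and its orientation runs from `x` to `y`. -/
def Below (x y : (i : Fin n) × Fin (D.len i)) : Prop :=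
  x.1 = y.1 ∧ (x.2 : ℕ) < (y.2 : ℕ)

open Classical in
/-- The intersection graph of `D`: a vertex for each chord, labeled by the components of its
endpoints, and a directed edge from `v` to `w` for each pair of an endpoint `e₁` of `v` and an
endpoint `e₂` of `w` with `e₁` below `e₂`, the edges being counted mod 2. -/
noncomputable def intersectionGraph : LabeledDigraph n k where
  label v := s((D.endpt (v, 0)).1, (D.endpt (v, 1)).1)
  edge v w := Odd (Finset.univ.filter fun p : Fin 2 × Fin 2 =>
    D.Below (D.endpt (v, p.1)) (D.endpt (w, p.2))).card

end StringChordDiagram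

/-- A chord diagram of degree `k` on oriented circles. The set `P` of marked points meets every
circle; `next` sends a marked point to the following one along its circle, so that the circles
are the cycles of `next` (fixed points included). The `v`-th chord joins the points `endpt (v, 0)`
and `endpt (v, 1)`; these are distinct for all chords. Marked points off all chords are allowed,
and only serve to represent circles without chords. -/
@[ext] structure LinkChordDiagram (P : Type) (k : ℕ) where
  /-- the following marked point along the circle -/
  next : Equiv.Perm P
  /-- the two endpoints of each chord -/
  endpt : Fin k × Fin 2 ↪ P

namespace LinkChordDiagram

variable {P : Type}

/-- The number of circles of a chord diagram. -/
noncomputable def circles {k : ℕ} (D : LinkChordDiagram P k) : ℕ :=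
  Nat.card (Quotient (Equiv.Perm.SameCycle.setoid D.next))

open Classical in
/-- Surgery on the chord `v`: the chord is replaced by a band, compatible with the orientation,
whose interior is removed together with the two intervals at which it is attached. So the strand
that arrives at one endpoint of `v` continues along the strand that left the other endpoint. The
other chords are kept. -/
noncomputable def surgery {k : ℕ} (D : LinkChordDiagram P (k + 1)) (v : Fin (k + 1)) :
    LinkChordDiagram P k where
  next := D.next * Equiv.swap (D.endpt (v, 0)) (D.endpt (v, 1))
  endpt := ⟨fun p => D.endpt (v.succAbove p.1, p.2), fun p q h => by
    have h' := D.endpt.injective h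
    simp only [Prod.mk.injEq, Fin.succAbove_right_inj] at h'
    exact Prod.ext h'.1 h'.2⟩

open Classical in
theorem surgery_next {k : ℕ} (D : LinkChordDiagram P (k + 1)) (v : Fin (k + 1)) :
    (D.surgery v).next = D.next * Equiv.swap (D.endpt (v, 0)) (D.endpt (v, 1)) := rfl

theorem surgery_endpt {k : ℕ} (D : LinkChordDiagram P (k + 1)) (v : Fin (k + 1))
    (p : Fin k × Fin 2) : (D.surgery v).endpt p = D.endpt (v.succAbove p.1, p.2) := rfl

/-- The Conway weight system on chord diagrams on circles: the chords are surgered one after the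
other, and a diagram without chords has the value `1` if it is a single circle, `0` otherwise. -/
noncomputable def conway : {k : ℕ} → LinkChordDiagram P k → ℤ
  | 0, D => if D.circles = 1 then 1 else 0
  | _ + 1, D => conway (D.surgery 0)

/-- The value of the Conway weight system on the unlink with `D.circles` components. -/
theorem conway_unlink (D : LinkChordDiagram P 0) :
    D.conway = if D.circles = 1 then 1 else 0 := rfl

theorem surgery_comm {k : ℕ} (D : LinkChordDiagram P (k + 2)) (u : Fin (k + 1)) :
    (D.surgery 0).surgery u = (D.surgery u.succ).surgery 0 := by
  classical
  have hne : ∀ a b : Fin 2, D.endpt (0, a) ≠ D.endpt (u.succ, b) := fun a b h =>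
    (Fin.succ_ne_zero u) (congrArg Prod.fst (D.endpt.injective h)).symm
  have hd : Equiv.Perm.Disjoint (Equiv.swap (D.endpt (0, 0)) (D.endpt (0, 1)))
      (Equiv.swap (D.endpt (u.succ, 0)) (D.endpt (u.succ, 1))) := by
    intro x
    by_cases h0 : x = D.endpt (0, 0)
    · right
      subst h0
      exact Equiv.swap_apply_of_ne_of_ne (hne _ _) (hne _ _)
    by_cases h1 : x = D.endpt (0, 1)
    · right
      subst h1
      exact Equiv.swap_apply_of_ne_of_ne (hne _ _) (hne _ _)
    · left
      exact Equiv.swap_apply_of_ne_of_ne h0 h1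
  have h0 : u.succ.succAbove 0 = 0 := Fin.succ_succAbove_zero u
  apply LinkChordDiagram.ext
  · have e1 : ((D.surgery 0).surgery u).next = D.next *
        Equiv.swap (D.endpt (0, 0)) (D.endpt (0, 1)) *
        Equiv.swap (D.endpt (u.succ, 0)) (D.endpt (u.succ, 1)) := by
      rw [surgery_next, surgery_next, surgery_endpt, surgery_endpt, Fin.zero_succAbove]
    have e2 : ((D.surgery u.succ).surgery 0).next = D.next *
        Equiv.swap (D.endpt (u.succ, 0)) (D.endpt (u.succ, 1)) *
        Equiv.swap (D.endpt (0, 0)) (D.endpt (0, 1)) := by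
      rw [surgery_next, surgery_next, surgery_endpt, surgery_endpt, h0]
    rw [e1, e2, mul_assoc, mul_assoc, hd.commute.eq]
  · ext p
    simp only [surgery_endpt, Fin.zero_succAbove, Fin.succ_succAbove_succ]

/-- The Conway weight system is invariant under surgery on an arbitrary chord. Together with
`conway_unlink` this determines it; in particular the order of the surgeries is irrelevant. -/
theorem conway_surgery : ∀ {k : ℕ} (D : LinkChordDiagram P (k + 1)) (v : Fin (k + 1)),
    D.conway = (D.surgery v).conway
  | 0, D, v => by
      obtain rfl : v = 0 := Fin.fin_one_eq_zero v
      rfl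
  | k + 1, D, v => by
      refine Fin.cases rfl (fun u => ?_) v
      calc D.conway = (D.surgery 0).conway := rfl
        _ = ((D.surgery 0).surgery u).conway := conway_surgery _ u
        _ = ((D.surgery u.succ).surgery 0).conway := by rw [surgery_comm]
        _ = (D.surgery u.succ).conway := rfl

end LinkChordDiagram

namespace StringChordDiagram

variable {n k : ℕ} (D : StringChordDiagram n k)

/-- The closure of a string link chord diagram: the top of each component is joined to its bottom.
On the `i`-th circle the point `0` marks the joint (so circles without endpoints are represented
too), and the endpoints follow in their order as `1, …, len i`. -/
def closure : LinkChordDiagram ((i : Fin n) × Fin (D.len i + 1)) k where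
  next := Equiv.sigmaCongrRight fun i => finRotate (D.len i + 1)
  endpt := ⟨fun p => ⟨(D.endpt p).1, (D.endpt p).2.succ⟩, fun p q h => by
    have key : ∀ x y : (i : Fin n) × Fin (D.len i),
        (⟨x.1, x.2.succ⟩ : (i : Fin n) × Fin (D.len i + 1)) = ⟨y.1, y.2.succ⟩ → x = y := by
      rintro ⟨i, x⟩ ⟨j, y⟩ hxy
      obtain ⟨rfl, hxy⟩ := Sigma.mk.inj_iff.1 hxy
      exact congrArg (Sigma.mk i) (Fin.succ_injective _ (eq_of_heq hxy))
    exact D.endpt.injective (key _ _ h)⟩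

/-- The Conway weight system of a string link chord diagram is that of its closure. -/
noncomputable def conway : ℤ := D.closure.conway

end StringChordDiagram

/-! Surgering all chords turns the successor permutation `next` into `next * S`, where `S` exchanges
the two ends of every chord, so a nonzero value of `C` means that `next * S` is a single cycle.
Parity: `next` is even and `S` has sign `(-1)^k`, whereas a single cycle on the `2k + n` marked
points has sign `(-1)^(2k+n+1)`; hence `k + n` is odd. Determinant: let `c` be in the left kernel of
the adjacency matrix, and let `F` at a point be the sum of the weights `c` met earlier on its
segment. The kernel equation at `v` says that the values of `F` at the two ends of `v` differ by `c
v`, which makes `F` constant along the surgered strands; at each joint it restarts from `0`. If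
there is only one curve, it runs through a joint, so `F` vanishes everywhere, and so does `c`. -/

/-! ### Signs of permutations -/

open Equiv in
theorem Equiv.Perm.sign_sigmaCongrRight {α : Type*} {β : α → Type*} [Fintype α] [DecidableEq α]
    [∀ a, Fintype (β a)] [∀ a, DecidableEq (β a)] (F : ∀ a, Perm (β a)) :
    Perm.sign (Perm.sigmaCongrRight F) = ∏ a, Perm.sign (F a) := by
  let φ : (∀ a, Perm (β a)) →* ℤˣ := Perm.sign.comp (Perm.sigmaCongrRightHom β)
  let ψ : (∀ a, Perm (β a)) →* ℤˣ :=
    { toFun := fun F => ∏ a, Perm.sign (F a)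
      map_one' := by simp
      map_mul' := fun F G => by simp [Finset.prod_mul_distrib] }
  suffices h : φ = ψ from DFunLike.congr_fun h F
  -- Homomorphisms on a finite product of groups agree once they agree on each factor; there the
  -- permutation is `σ` extended by the identity off one fibre.
  refine MonoidHom.pi_ext fun a σ => ?_
  have h1 : ψ (Pi.mulSingle a σ) = Perm.sign σ := by
    change ∏ b, Perm.sign ((Pi.mulSingle a σ : ∀ a, Perm (β a)) b) = _
    rw [Finset.prod_eq_single a]
    · simp
    · intro b _ hb
      simp [Pi.mulSingle_eq_of_ne hb]
    · simp
  rw [h1]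
  let e : β a ↪ Sigma β := ⟨Sigma.mk a, sigma_mk_injective⟩
  have h2 : Perm.sigmaCongrRight (Pi.mulSingle a σ) = σ.viaFintypeEmbedding e := by
    ext1 ⟨b, y⟩
    by_cases hb : b = a
    · subst hb
      have := σ.viaFintypeEmbedding_apply_image e y
      change _ = σ.viaFintypeEmbedding e (e y)
      rw [this]
      simp [e]
    · rw [Perm.viaFintypeEmbedding_apply_notMem_range]
      · simp [Pi.mulSingle_eq_of_ne hb]
      · rintro ⟨z, hz⟩
        exact hb (congrArg Sigma.fst hz).symm
  change Perm.sign (Perm.sigmaCongrRight (Pi.mulSingle a σ)) = _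
  rw [h2, Perm.viaFintypeEmbedding_sign]

/-- A permutation with exactly one cycle, fixed points included. -/
theorem Equiv.Perm.sign_of_forall_sameCycle {α : Type*} [Fintype α] [DecidableEq α]
    (f : Equiv.Perm α) (x : α) (h : ∀ y, f.SameCycle x y) :
    Equiv.Perm.sign f = (-1) ^ (Fintype.card α + 1) := by
  -- `IsCycle` excludes the identity, so a single point is treated apart.
  rcases subsingleton_or_nontrivial α with hα | hα
  · have : Fintype.card α = 1 := Fintype.card_eq_one_iff.2 ⟨x, fun y => Subsingleton.elim _ _⟩
    rw [this, Subsingleton.elim f 1]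
    simp
  · have hx : f x ≠ x := fun hx => by
      obtain ⟨y, hy⟩ := exists_ne x
      obtain ⟨m, rfl⟩ := h y
      exact hy (Equiv.Perm.zpow_apply_eq_self_of_apply_eq_self hx m)
    have hc : f.IsCycle := ⟨x, hx, fun y _ => h y⟩
    have hs : f.support = Finset.univ := by
      ext y
      simp only [Equiv.Perm.mem_support, Finset.mem_univ, iff_true]
      exact fun hy => hx (((h y).apply_eq_self_iff).2 hy)
    rw [hc.sign, hs, Finset.card_univ, pow_succ]
    simp

/-! ### Surgery on all chords at once -/

namespace LinkChordDiagram

variable {P : Type}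

/-- Surgery on all chords composes `next` with the involution that exchanges the two endpoints of
every chord; this involution has sign `(-1) ^ k`. -/
theorem exists_conway_eq [Fintype P] [DecidableEq P] : ∀ {k : ℕ} (D : LinkChordDiagram P k),
    ∃ S : Equiv.Perm P,
      (∀ v, S (D.endpt (v, 0)) = D.endpt (v, 1)) ∧ (∀ v, S (D.endpt (v, 1)) = D.endpt (v, 0)) ∧
      (∀ x ∉ Set.range D.endpt, S x = x) ∧ Equiv.Perm.sign S = (-1) ^ k ∧
      D.conway =
        if Nat.card (Quotient (Equiv.Perm.SameCycle.setoid (D.next * S))) = 1 then 1 else 0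
  | 0, D => ⟨1, fun v => v.elim0, fun v => v.elim0, fun _ _ => rfl, by simp, by
      rw [mul_one]; rfl⟩
  | k + 1, D => by
      obtain ⟨S, h0, h1, hS, hsign, hc⟩ := exists_conway_eq (D.surgery 0)
      have hne : ∀ (a b : Fin 2) (u : Fin k), D.endpt (u.succ, b) ≠ D.endpt (0, a) :=
        fun a b u h => Fin.succ_ne_zero u (congrArg Prod.fst (D.endpt.injective h))
      have hfix : ∀ a, S (D.endpt (0, a)) = D.endpt (0, a) := fun a => hS _ <| by
        rintro ⟨⟨u, b⟩, hu⟩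
        exact hne a b u hu
      have h0' : ∀ u : Fin k, S (D.endpt (u.succ, 0)) = D.endpt (u.succ, 1) := h0
      have h1' : ∀ u : Fin k, S (D.endpt (u.succ, 1)) = D.endpt (u.succ, 0) := h1
      -- The swap stands to the left of `S` because the first surgery multiplies `next` by it on the
      -- right.
      refine ⟨Equiv.swap (D.endpt (0, 0)) (D.endpt (0, 1)) * S, ?_, ?_, ?_, ?_, ?_⟩
      · intro v
        refine Fin.cases ?_ (fun u => ?_) v
        · simp [hfix]
        · rw [Equiv.Perm.mul_apply, h0', Equiv.swap_apply_of_ne_of_ne (hne _ _ _) (hne _ _ _)]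
      · intro v
        refine Fin.cases ?_ (fun u => ?_) v
        · simp [hfix]
        · rw [Equiv.Perm.mul_apply, h1', Equiv.swap_apply_of_ne_of_ne (hne _ _ _) (hne _ _ _)]
      · intro x hx
        have hx' : x ∉ Set.range (D.surgery 0).endpt := by
          rintro ⟨⟨u, b⟩, hu⟩
          exact hx ⟨(u.succ, b), hu⟩
        rw [Equiv.Perm.mul_apply, hS x hx', Equiv.swap_apply_of_ne_of_ne]
        · rintro rfl; exact hx ⟨_, rfl⟩
        · rintro rfl; exact hx ⟨_, rfl⟩
      · rw [Equiv.Perm.sign_mul, hsign, Equiv.Perm.sign_swap, pow_succ']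
        exact fun h => zero_ne_one (congrArg Prod.snd (D.endpt.injective h))
      · rw [← mul_assoc]
        change (D.surgery 0).conway = _
        rw [hc, surgery_next]
        congr!

end LinkChordDiagram

/-! ### Kernel vectors as weights on the chords -/

namespace StringChordDiagram

variable {n k : ℕ} (D : StringChordDiagram n k)

open Classical in
/-- The sum of the weights `c` of the chords over all chord endpoints on the `i`-th component that
have a number less than `m`. -/
noncomputable def weightBelow (c : Fin k → ZMod 2) (i : Fin n) (m : ℕ) : ZMod 2 :=
  ∑ p : Fin k × Fin 2, if (D.endpt p).1 = i ∧ ((D.endpt p).2 : ℕ) < m then c p.1 else 0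

theorem weightBelow_zero (c : Fin k → ZMod 2) (i : Fin n) : D.weightBelow c i 0 = 0 := by
  simp [weightBelow]

/-- Raising the bound by one admits only the endpoint `p`, since `endpt` is injective. -/
theorem weightBelow_succ (c : Fin k → ZMod 2) (p : Fin k × Fin 2) :
    D.weightBelow c (D.endpt p).1 ((D.endpt p).2 + 1) =
      D.weightBelow c (D.endpt p).1 (D.endpt p).2 + c p.1 := by
  classical
  have hp : c p.1 = ∑ q : Fin k × Fin 2, if q = p then c q.1 else 0 := by simp
  rw [hp, weightBelow, weightBelow, ← Finset.sum_add_distrib]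
  refine Finset.sum_congr rfl fun q _ => ?_
  by_cases hq : q = p
  · subst hq
    simp
  · have hne : ¬((D.endpt q).1 = (D.endpt p).1 ∧ ((D.endpt q).2 : ℕ) = (D.endpt p).2) := by
      rintro ⟨h1, h2⟩
      refine hq (D.endpt.injective (Sigma.ext h1 ?_))
      exact (Fin.heq_ext_iff (congrArg D.len h1)).2 h2
    have hiff : ((D.endpt q).1 = (D.endpt p).1 ∧ ((D.endpt q).2 : ℕ) < (D.endpt p).2 + 1) ↔
        ((D.endpt q).1 = (D.endpt p).1 ∧ ((D.endpt q).2 : ℕ) < (D.endpt p).2) := by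
      refine ⟨fun h => ⟨h.1, ?_⟩, fun h => ⟨h.1, by omega⟩⟩
      have : ((D.endpt q).2 : ℕ) ≠ (D.endpt p).2 := fun h2 => hne ⟨h.1, h2⟩
      omega
    simp only [hq, hiff, if_false, add_zero]

open Classical in
/-- The number of directed edges between two chords, before cancelling, in terms of the adjacency
matrix. -/
theorem card_below_eq (w v : Fin k) :
    ((Finset.univ.filter fun p : Fin 2 × Fin 2 =>
      D.Below (D.endpt (w, p.1)) (D.endpt (v, p.2))).card : ZMod 2) =
      D.intersectionGraph.adj w v + if w = v then 1 else 0 := by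
  -- On the diagonal the count is `1` exactly when both ends share a component, the opposite of the
  -- convention for `adj`; hence the correction by `1`.
  by_cases hwv : w = v
  · subst hwv
    have hirr : ∀ x, ¬D.Below x x := fun x h => lt_irrefl _ h.2
    rw [Finset.card_filter, Fintype.sum_prod_type]
    simp only [Fin.sum_univ_two, hirr, if_false, zero_add, add_zero, LabeledDigraph.adj,
      Matrix.of_apply, if_true, intersectionGraph, Sym2.mk_isDiag_iff]
    by_cases h : (D.endpt (w, 0)).1 = (D.endpt (w, 1)).1
    · have hne : ((D.endpt (w, 0)).2 : ℕ) ≠ (D.endpt (w, 1)).2 := fun h2 => by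
        have := D.endpt.injective
          (Sigma.ext h ((Fin.heq_ext_iff (congrArg D.len h)).2 h2))
        exact zero_ne_one (congrArg Prod.snd this)
      rcases lt_or_gt_of_ne hne with h' | h'
      · simp [Below, h, h', h'.le]
      · simp [Below, h, h', h'.le]
    · have h2 : ¬(D.endpt (w, 1)).1 = (D.endpt (w, 0)).1 := fun h2 => h h2.symm
      simp only [Below, h, h2, false_and, if_false]
      decide
  · simp only [LabeledDigraph.adj, Matrix.of_apply, hwv, if_false, add_zero]
    by_cases h : D.intersectionGraph.edge w v
    · rw [if_pos h]
      exact ZMod.natCast_eq_one_iff_odd.2 h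
    · rw [if_neg h]
      exact ZMod.natCast_eq_zero_iff_even.2 (Nat.not_odd_iff_even.1 h)

/-- Grouped by chords `w`, the left side is the sum of `c w` times the number of edges from `w` to
`v`; the extra `c v` is the diagonal correction in `card_below_eq`. -/
theorem weightBelow_add_weightBelow (c : Fin k → ZMod 2) (v : Fin k) :
    D.weightBelow c (D.endpt (v, 0)).1 (D.endpt (v, 0)).2 +
      D.weightBelow c (D.endpt (v, 1)).1 (D.endpt (v, 1)).2 =
      Matrix.vecMul c D.intersectionGraph.adj v + c v := by
  classical
  have hv : c v = ∑ w, c w * if w = v then 1 else 0 := by simp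
  rw [hv, Matrix.vecMul, dotProduct, ← Finset.sum_add_distrib, weightBelow, weightBelow,
    Fintype.sum_prod_type, Fintype.sum_prod_type, ← Finset.sum_add_distrib]
  refine Finset.sum_congr rfl fun w _ => ?_
  rw [← mul_add, ← card_below_eq, Finset.card_filter, Fintype.sum_prod_type]
  simp only [Fin.sum_univ_two, Nat.cast_add, Nat.cast_ite, Nat.cast_one, Nat.cast_zero,
    mul_add, mul_ite, mul_one, mul_zero]
  rw [add_add_add_comm]
  congr!

/-- If the closure becomes a single circle when all its chords are surgered, then the adjacency
matrix of the intersection graph is invertible. -/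
theorem det_adj_ne_zero_of_forall_sameCycle
    {S : Equiv.Perm ((i : Fin n) × Fin (D.len i + 1))}
    (h0 : ∀ v, S (D.closure.endpt (v, 0)) = D.closure.endpt (v, 1))
    (h1 : ∀ v, S (D.closure.endpt (v, 1)) = D.closure.endpt (v, 0))
    (hS : ∀ x ∉ Set.range D.closure.endpt, S x = x) (i : Fin n)
    (hcyc : ∀ y, (D.closure.next * S).SameCycle ⟨i, 0⟩ y) :
    D.intersectionGraph.adj.det ≠ 0 := by
  intro hdet
  obtain ⟨c, hc0, hc⟩ := Matrix.exists_vecMul_eq_zero_iff.2 hdet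
  -- `F` is constant along the surgered strands, except that it drops to `0` at the joints.
  let F : (i : Fin n) × Fin (D.len i + 1) → ZMod 2 := fun x =>
    D.weightBelow c x.1 ((finRotate (D.len x.1 + 1)).symm x.2 : ℕ)
  have hnext : ∀ x, F (D.closure.next x) = D.weightBelow c x.1 x.2 := fun x => by
    simp [F, closure]
  -- Endpoint number `j` is point `j + 1` of the circle, as `0` is the joint; the predecessor in `F`
  -- undoes this shift.
  have hend : ∀ p, F (D.closure.endpt p) = D.weightBelow c (D.endpt p).1 (D.endpt p).2 :=
    fun p => by
      have : (finRotate (D.len (D.endpt p).1 + 1)).symm (D.endpt p).2.succ =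
          (D.endpt p).2.castSucc := by
        rw [Equiv.symm_apply_eq, finRotate_apply, Fin.coeSucc_eq_succ]
      change D.weightBelow c (D.endpt p).1 ((finRotate _).symm (D.endpt p).2.succ : ℕ) = _
      rw [this, Fin.val_castSucc]
  have hnextend : ∀ p, F (D.closure.next (D.closure.endpt p)) =
      F (D.closure.endpt p) + c p.1 := fun p => by
    rw [hnext, hend, ← weightBelow_succ]
    rfl
  -- The only use of the kernel equation.
  have hjump : ∀ v, F (D.closure.endpt (v, 0)) + F (D.closure.endpt (v, 1)) = c v := fun v => by
    rw [hend, hend, weightBelow_add_weightBelow, hc, Pi.zero_apply, zero_add]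
  have hstep : ∀ p, F ((D.closure.next * S) (D.closure.endpt p)) = F (D.closure.endpt p) := by
    rintro ⟨v, b⟩
    have h2 : ∀ a b c : ZMod 2, a + b = c → b + c = a ∧ a + c = b := by decide
    obtain ⟨e0, e1⟩ := h2 _ _ _ (hjump v)
    fin_cases b
    · change F (D.closure.next (S _)) = _
      exact (congrArg (fun x => F (D.closure.next x)) (h0 v)).trans ((hnextend _).trans e0)
    · change F (D.closure.next (S _)) = _
      exact (congrArg (fun x => F (D.closure.next x)) (h1 v)).trans ((hnextend _).trans e1)
  -- A point off all chords is a joint, and no endpoint precedes its successor.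
  have hjoint : ∀ x ∉ Set.range D.closure.endpt, F ((D.closure.next * S) x) = 0 := by
    rintro ⟨j, q⟩ hx
    rw [Equiv.Perm.mul_apply, hS _ hx, hnext]
    refine Fin.cases ?_ (fun q hx => ?_) q hx
    · intro _
      exact D.weightBelow_zero c j
    · obtain ⟨p, hp⟩ := D.endpt.surjective ⟨j, q⟩
      refine absurd ⟨p, ?_⟩ hx
      change (⟨(D.endpt p).1, (D.endpt p).2.succ⟩ : (i : Fin n) × Fin (D.len i + 1)) = _
      rw [hp]
  -- The exponent starts at `1`: at the joint itself `F` is the total weight of the component, known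
  -- to vanish only once the curve returns there.
  have hzero : ∀ m : ℕ, F (((D.closure.next * S) ^ (m + 1)) ⟨i, 0⟩) = 0 := by
    have hi : (⟨i, 0⟩ : (i : Fin n) × Fin (D.len i + 1)) ∉ Set.range D.closure.endpt := by
      rintro ⟨p, hp⟩
      have hp' : (⟨(D.endpt p).1, (D.endpt p).2.succ⟩ : (i : Fin n) × Fin (D.len i + 1)) =
        ⟨i, 0⟩ := hp
      obtain ⟨rfl, h⟩ := Sigma.mk.inj_iff.1 hp'
      exact Fin.succ_ne_zero _ (eq_of_heq h)
    intro m
    induction m with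
    | zero => simpa using hjoint _ hi
    | succ m ih =>
      rw [pow_succ', Equiv.Perm.mul_apply]
      by_cases hx : ((D.closure.next * S) ^ (m + 1)) ⟨i, 0⟩ ∈ Set.range D.closure.endpt
      · obtain ⟨p, hp⟩ := hx
        rw [← hp, hstep, hp, ih]
      · exact hjoint _ hx
  have hF : ∀ y, F y = 0 := fun y => by
    obtain ⟨m, hm, -, rfl⟩ := (hcyc y).exists_pow_eq''
    obtain ⟨m, rfl⟩ := Nat.exists_eq_succ_of_ne_zero hm.ne'
    exact hzero m
  refine hc0 (funext fun v => ?_)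
  rw [← hjump v, hF, hF]
  rfl

theorem sum_len : ∑ i, D.len i = k * 2 := by
  have := Fintype.card_congr D.endpt
  simpa using this.symm

/-- The `i`-th circle is a cycle on `len i + 1` points, of sign `(-1)^(len i)`, and the lengths add
up to `2k`. -/
theorem sign_closure_next : Equiv.Perm.sign D.closure.next = 1 := by
  rw [closure, Equiv.Perm.sign_sigmaCongrRight]
  simp only [sign_finRotate, Nat.add_sub_cancel]
  rw [Finset.prod_pow_eq_pow_sum, sum_len, mul_comm, pow_mul]
  simp

end StringChordDiagram

theorem propositionP (n k : ℕ) (D : StringChordDiagram n k)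
    (h : D.intersectionGraph.adj.det = 0 ∨ Even (k + n)) :
    D.conway = 0 := by
  obtain ⟨S, h0, h1, hS, hsign, hc⟩ := D.closure.exists_conway_eq
  rw [StringChordDiagram.conway, hc, if_neg]
  intro hcard
  obtain ⟨hsub, ⟨q⟩⟩ := Nat.card_eq_one_iff_unique.1 hcard
  -- The existing cycle supplies a component, whose joint serves as base point.
  obtain ⟨⟨i, -⟩, -⟩ := q.exists_rep
  have hcyc : ∀ y, (D.closure.next * S).SameCycle ⟨i, 0⟩ y := fun y =>
    Quotient.exact (s := Equiv.Perm.SameCycle.setoid (D.closure.next * S))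
      (Subsingleton.elim (Quotient.mk _ ⟨i, 0⟩) (Quotient.mk _ y))
  rcases h with h | h
  · exact D.det_adj_ne_zero_of_forall_sameCycle h0 h1 hS i hcyc h
  · have hs := Equiv.Perm.sign_of_forall_sameCycle _ _ hcyc
    have hP : Fintype.card ((i : Fin n) × Fin (D.len i + 1)) = k * 2 + n := by
      simp [Finset.sum_add_distrib, D.sum_len]
    rw [Equiv.Perm.sign_mul, hsign, D.sign_closure_next, one_mul, hP] at hs
    rcases Nat.even_or_odd k with hk | hk
    · have hn : Odd (k * 2 + n + 1) := by grind
      rw [hk.neg_one_pow, hn.neg_one_pow] at hs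
      exact absurd hs (by decide)
    · have hn : Even (k * 2 + n + 1) := by grind
      rw [hk.neg_one_pow, hn.neg_one_pow] at hs
      exact absurd hs (by decide)
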